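/- Let $l,m\ge 1$ be integers and let $(P_0,\dots,P_m)$ be a symmetric Clifford system on $\mathbb{R}^{2l}$, i.e. the $P_i$ are symmetric endomorphisms of $\mathbb{R}^{2l}$ with $P_iP_j+P_jP_i=2\delta_{ij}\,\mathrm{Id}$ for all $i,j\in\{0,\dots,m\}$. Put $m_1:=m$, $m_2:=l-m-1$ and $$F:\mathbb{R}^{2l}\to\mathbb{R},\qquad F(x)=\langle x,x\rangle^2-2\sum_{i=0}^m\langle P_ix,x\rangle^2 .$$ Then $F$ is smooth and satisfies the Cartan–Münzner differential equations $$\|\operatorname{grad}F(x)\|^2=16\|x\|^6,\qquad \Delta F(x)=8(m_2-m_1)\|x\|^2\qquad(x\in\mathbb{R}^{2l}).$$ If moreover $m_2>0$, then the levels of $F$ on the unit sphere, $M_c:=\{x\in S^{2l-1}: F(x)=c\}$, form an isoparametric family with $g=4$ distinct principal curvatures with multiplicities $(m_1,m_2)$. In detail: $F(S^{2l-1})=[-1,1]$. Let $f=F|_{S^{2l-1}}$ and let $\xi=\operatorname{grad}f/\|\operatorname{grad}f\|$, with the gradient taken in the sphere. 1. For every $c\in(-1,1)$, $M_c$ is a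 nonempty smooth embedded hypersurface of $S^{2l-1}$ with smooth unit normal field $\xi$. The shape operator $V\mapsto-\nabla_V\xi$ has, at every point of $M_c$, the same four distinct eigenvalues $\kappa_1>\kappa_2>\kappa_3>\kappa_4$ (depending only on $c$) and no others, with eigenspaces of dimensions $m_1,m_2,m_1,m_2$ in this order. 2. For all $c,c'\in(-1,1)$ there is an $\varepsilon\in\mathbb{R}$ such that $M_{c'}=\{\cos\varepsilon\,x+\sin\varepsilon\,\xi(x): x\in M_c\}$ and $\xi(\cos\varepsilon\,x+\sin\varepsilon\,\xi(x))=-\sin\varepsilon\,x+\cos\varepsilon\,\xi(x)$ for all $x\in M_c$. 3. For every $c\in(-1,1)$, the sets $\{\cos\varepsilon\,x+\sin\varepsilon\,\xi(x): x\in M_c\}$, $\varepsilon\in\mathbb{R}$, are exactly the levels $M_{c'}$, $c'\in[-1,1]$. -/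

import Mathlib

open scoped Gradient Laplacian InnerProductSpace ContDiff

/-- `(P_0, …, P_m)` is a symmetric Clifford system on `ℝ^{2l}`: the `P_i` are symmetric
endomorphisms with `P_i P_j + P_j P_i = 2 δ_{ij} Id`. -/
structure IsCliffordSystem {l m : ℕ}
    (P : Fin (m + 1) → EuclideanSpace ℝ (Fin (2 * l)) →ₗ[ℝ] EuclideanSpace ℝ (Fin (2 * l))) :
    Prop where
  symmetric : ∀ i, (P i).IsSymmetric
  anticomm : ∀ i j, P i ∘ₗ P j + P j ∘ₗ P i = (if i = j then (2 : ℝ) else 0) • LinearMap.id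

/-- The quartic `F(x) = ⟨x,x⟩² - 2 ∑ ⟨P_i x, x⟩²`. -/
noncomputable def cliffordQuartic {l m : ℕ}
    (P : Fin (m + 1) → EuclideanSpace ℝ (Fin (2 * l)) →ₗ[ℝ] EuclideanSpace ℝ (Fin (2 * l)))
    (x : EuclideanSpace ℝ (Fin (2 * l))) : ℝ :=
  ⟪x, x⟫_ℝ ^ 2 - 2 * ∑ i, ⟪P i x, x⟫_ℝ ^ 2

/-- The gradient at the point `x` of the unit sphere of the restriction of `f` to that sphere:
the component of the Euclidean gradient orthogonal to `x`. -/
noncomputable def sphereGradient {n : ℕ} (f : EuclideanSpace ℝ (Fin n) → ℝ)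
    (x : EuclideanSpace ℝ (Fin n)) : EuclideanSpace ℝ (Fin n) :=
  ∇ f x - ⟪∇ f x, x⟫_ℝ • x

/-- The normalized spherical gradient `grad f / ‖grad f‖`. -/
noncomputable def unitSphereGradient {n : ℕ} (f : EuclideanSpace ℝ (Fin n) → ℝ)
    (x : EuclideanSpace ℝ (Fin n)) : EuclideanSpace ℝ (Fin n) :=
  ‖sphereGradient f x‖⁻¹ • sphereGradient f x

/-- The level set `{x ∈ S^{n-1} | f x = c}`. -/
def sphereLevel {n : ℕ} (f : EuclideanSpace ℝ (Fin n) → ℝ) (c : ℝ) :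
    Set (EuclideanSpace ℝ (Fin n)) :=
  {x | x ∈ Metric.sphere (0 : EuclideanSpace ℝ (Fin n)) 1 ∧ f x = c}

/-- `M` is a (nonempty, smooth, embedded) hypersurface of the unit sphere `S^{n-1}`, oriented by
the smooth unit normal field `ξ`: near each of its points, `M` is the zero set in the sphere of a
smooth function `φ` whose spherical gradient does not vanish along `M` and is proportional
to `ξ`. The values of `ξ` away from a neighbourhood of `M` are irrelevant. -/
structure IsOrientedHypersurface {n : ℕ} (M : Set (EuclideanSpace ℝ (Fin n)))
    (ξ : EuclideanSpace ℝ (Fin n) → EuclideanSpace ℝ (Fin n)) : Prop where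
  nonempty : M.Nonempty
  subset_sphere : M ⊆ Metric.sphere 0 1
  smooth_normal : ∃ U, IsOpen U ∧ M ⊆ U ∧ ContDiffOn ℝ ∞ ξ U
  norm_normal : ∀ x ∈ M, ‖ξ x‖ = 1
  locally_zero_set : ∀ x ∈ M, ∃ (V : Set (EuclideanSpace ℝ (Fin n)))
    (φ : EuclideanSpace ℝ (Fin n) → ℝ), IsOpen V ∧ x ∈ V ∧ ContDiffOn ℝ ∞ φ V ∧
      M ∩ V = sphereLevel φ 0 ∩ V ∧
      ∀ y ∈ M ∩ V, sphereGradient φ y ≠ 0 ∧ ∃ a : ℝ, sphereGradient φ y = a • ξ y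

/-- The tangent space at `x` of a hypersurface of the sphere with unit normal field `ξ`: the
vectors orthogonal to the position vector `x` (tangent to the sphere) and to `ξ x`. -/
noncomputable def hypersurfaceTangentSpace {n : ℕ}
    (ξ : EuclideanSpace ℝ (Fin n) → EuclideanSpace ℝ (Fin n)) (x : EuclideanSpace ℝ (Fin n)) :
    Submodule ℝ (EuclideanSpace ℝ (Fin n)) :=
  (Submodule.span ℝ {x, ξ x})ᗮ

/-- The shape operator (Weingarten map) `V ↦ -∇_V ξ` on the tangent space at `x`: the tangential
part of minus the directional derivative of the unit normal field. -/
noncomputable def shapeOperator {n : ℕ}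
    (ξ : EuclideanSpace ℝ (Fin n) → EuclideanSpace ℝ (Fin n)) (x : EuclideanSpace ℝ (Fin n)) :
    Module.End ℝ (hypersurfaceTangentSpace ξ x) :=
  -((hypersurfaceTangentSpace ξ x).orthogonalProjectionOnto.toLinearMap ∘ₗ
    (fderiv ℝ ξ x).toLinearMap ∘ₗ (hypersurfaceTangentSpace ξ x).subtype)

/-- `M`, oriented by `ξ`, is an isoparametric hypersurface of the sphere with exactly `g` distinct
principal curvatures, all constant on `M`, whose multiplicities, listed in the order of
decreasing principal curvature, are `mult 0, …, mult (g - 1)`. -/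
structure IsIsoparametricHypersurface {n : ℕ} (M : Set (EuclideanSpace ℝ (Fin n)))
    (ξ : EuclideanSpace ℝ (Fin n) → EuclideanSpace ℝ (Fin n)) (g : ℕ) (mult : Fin g → ℤ) :
    Prop where
  hypersurface : IsOrientedHypersurface M ξ
  constant_curvatures : ∃ κ : Fin g → ℝ, StrictAnti κ ∧ ∀ x ∈ M,
    (∀ r : ℝ, (shapeOperator ξ x).HasEigenvalue r ↔ ∃ i, r = κ i) ∧
    ∀ i, (Module.finrank ℝ ((shapeOperator ξ x).eigenspace (κ i)) : ℤ) = mult i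

/-- The point at spherical distance `ε` from `x` on the normal great circle in direction `ξ x`. -/
noncomputable def parallelMap {n : ℕ}
    (ξ : EuclideanSpace ℝ (Fin n) → EuclideanSpace ℝ (Fin n)) (ε : ℝ)
    (x : EuclideanSpace ℝ (Fin n)) : EuclideanSpace ℝ (Fin n) :=
  Real.cos ε • x + Real.sin ε • ξ x

/-- The sets `M i`, oriented by `ξ i`, form an isoparametric family: they are isoparametric
hypersurfaces with `g` distinct principal curvatures of the given multiplicities, and any two of
them are parallel, with the same normal great circles and corresponding unit normals. -/
structure IsIsoparametricFamily {n : ℕ} {ι : Type*} (M : ι → Set (EuclideanSpace ℝ (Fin n)))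
    (ξ : ι → EuclideanSpace ℝ (Fin n) → EuclideanSpace ℝ (Fin n)) (g : ℕ) (mult : Fin g → ℤ) :
    Prop where
  isoparametric : ∀ i, IsIsoparametricHypersurface (M i) (ξ i) g mult
  parallel : ∀ i j, ∃ ε : ℝ, parallelMap (ξ i) ε '' M i = M j ∧
    ∀ x ∈ M i, ξ j (parallelMap (ξ i) ε x) = -Real.sin ε • x + Real.cos ε • ξ i x

/-! Write C(p) = ∑ pᵢPᵢ and B(x,y) = (⟨Pᵢx,y⟩)ᵢ, so that ⟨p,B(x,y)⟩ = ⟨C(p)x,y⟩, C(p)² = ‖p‖² Id and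
F(x) = ‖x‖⁴ - 2‖B(x,x)‖². The gradient of F is 4‖x‖²x - 8C(B(x,x))x. In its squared norm the two
terms in ‖B(x,x)‖² cancel because ‖C(p)x‖ = ‖p‖‖x‖. In the Laplacian the term with C(B(x,x)) drops
out because every C(p) has trace zero.

The geometry rests on normal frames (`IsNormalFrame`): orthonormal x, ξ and a unit p such that B on
their plane is p times a traceless symmetric form of angle 2τ. Then F(x) = cos 4τ, and ξ is the unit
gradient when sin 4τ > 0. Rotating the plane by ε replaces τ by τ - ε (`IsNormalFrame.rotate`).
Since every point of the sphere has a frame (`exists_isNormalFrame`), focal points included, the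
parallel sets of a regular level are exactly the levels.

For the curvatures, the derivative of the unit gradient is computed modulo span(x, ξ). Eigenvectors
come from the ±1-eigenspaces of C(p) cut down by B(x,v) = 0, of dimension at least l-m-1 each, and
from combinations of C(q)x and C(p)C(q)x with q ⊥ p, two families of dimension m. These bounds add
up to 2l-2, the dimension of the tangent space, so all of them are equalities and there are no other
eigenvalues. -/

/-! ### Algebra of the Clifford sphere -/

section Clifford

variable {l m : ℕ}
  {P : Fin (m + 1) → EuclideanSpace ℝ (Fin (2 * l)) →ₗ[ℝ] EuclideanSpace ℝ (Fin (2 * l))}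

/-- The endomorphism `∑ pᵢ Pᵢ`, as a linear function of `p`. -/
noncomputable def cliffordMap
    (P : Fin (m + 1) → EuclideanSpace ℝ (Fin (2 * l)) →ₗ[ℝ] EuclideanSpace ℝ (Fin (2 * l))) :
    EuclideanSpace ℝ (Fin (m + 1)) →ₗ[ℝ]
      EuclideanSpace ℝ (Fin (2 * l)) →ₗ[ℝ] EuclideanSpace ℝ (Fin (2 * l)) :=
  LinearMap.mk₂ ℝ (fun p x => ∑ i, p i • P i x)
    (fun p q x => by simp [add_smul, Finset.sum_add_distrib])
    (fun c p x => by simp [mul_smul, Finset.smul_sum])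
    (fun p x y => by simp [Finset.sum_add_distrib])
    (fun c p x => by simp [Finset.smul_sum, smul_comm c])

/-- The vector-valued bilinear form with components `⟨Pᵢ x, y⟩`. -/
noncomputable def cliffordForm
    (P : Fin (m + 1) → EuclideanSpace ℝ (Fin (2 * l)) →ₗ[ℝ] EuclideanSpace ℝ (Fin (2 * l))) :
    EuclideanSpace ℝ (Fin (2 * l)) →ₗ[ℝ]
      EuclideanSpace ℝ (Fin (2 * l)) →ₗ[ℝ] EuclideanSpace ℝ (Fin (m + 1)) :=
  LinearMap.mk₂ ℝ (fun x y => WithLp.toLp 2 fun i => ⟪P i x, y⟫_ℝ)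
    (fun x y z => by ext i; simp [inner_add_left])
    (fun c x y => by ext i; simp [inner_smul_left])
    (fun x y z => by ext i; simp [inner_add_right])
    (fun c x y => by ext i; simp [inner_smul_right])

theorem cliffordMap_apply (p : EuclideanSpace ℝ (Fin (m + 1)))
    (x : EuclideanSpace ℝ (Fin (2 * l))) : cliffordMap P p x = ∑ i, p i • P i x := rfl

theorem cliffordForm_apply (x y : EuclideanSpace ℝ (Fin (2 * l))) (i : Fin (m + 1)) :
    cliffordForm P x y i = ⟪P i x, y⟫_ℝ := rfl

theorem cliffordMap_cliffordForm (x y z : EuclideanSpace ℝ (Fin (2 * l))) :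
    cliffordMap P (cliffordForm P x y) z = ∑ i, ⟪P i x, y⟫_ℝ • P i z := rfl

theorem inner_cliffordForm (p : EuclideanSpace ℝ (Fin (m + 1)))
    (x y : EuclideanSpace ℝ (Fin (2 * l))) :
    ⟪p, cliffordForm P x y⟫_ℝ = ⟪cliffordMap P p x, y⟫_ℝ := by
  simp [cliffordMap_apply, cliffordForm_apply, PiLp.inner_apply, sum_inner, inner_smul_left,
    mul_comm]

theorem cliffordQuartic_eq (x : EuclideanSpace ℝ (Fin (2 * l))) :
    cliffordQuartic P x = ‖x‖ ^ 4 - 2 * ‖cliffordForm P x x‖ ^ 2 := by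
  rw [EuclideanSpace.norm_sq_eq, cliffordQuartic, real_inner_self_eq_norm_sq]
  simp [cliffordForm_apply]
  ring

theorem inner_cliffordMap_left (hP : IsCliffordSystem P) (p : EuclideanSpace ℝ (Fin (m + 1)))
    (x y : EuclideanSpace ℝ (Fin (2 * l))) :
    ⟪cliffordMap P p x, y⟫_ℝ = ⟪x, cliffordMap P p y⟫_ℝ := by
  simp only [cliffordMap_apply, sum_inner, inner_sum, inner_smul_left, inner_smul_right,
    hP.symmetric _ x y]
  simp

theorem cliffordForm_comm (hP : IsCliffordSystem P) (x y : EuclideanSpace ℝ (Fin (2 * l))) :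
    cliffordForm P x y = cliffordForm P y x := by
  ext i
  rw [cliffordForm_apply, cliffordForm_apply, hP.symmetric i x y, real_inner_comm]

theorem cliffordMap_anticomm (hP : IsCliffordSystem P) (p q : EuclideanSpace ℝ (Fin (m + 1)))
    (x : EuclideanSpace ℝ (Fin (2 * l))) :
    cliffordMap P p (cliffordMap P q x) + cliffordMap P q (cliffordMap P p x) =
      (2 * ⟪p, q⟫_ℝ) • x := by
  have h : ∀ i j, P i (P j x) + P j (P i x) = (if i = j then (2 : ℝ) else 0) • x := fun i j => by
    simpa only [LinearMap.add_apply, LinearMap.comp_apply, LinearMap.smul_apply,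
      LinearMap.id_apply] using LinearMap.congr_fun (hP.anticomm i j) x
  have e : cliffordMap P q (cliffordMap P p x) = ∑ i, ∑ j, (p i * q j) • P j (P i x) := by
    simp [cliffordMap_apply, Finset.smul_sum, smul_smul]
  have e' : cliffordMap P p (cliffordMap P q x) = ∑ i, ∑ j, (p i * q j) • P i (P j x) := by
    rw [Finset.sum_comm]
    simp [cliffordMap_apply, Finset.smul_sum, smul_smul, mul_comm]
  rw [e, e']
  simp only [← Finset.sum_add_distrib, ← smul_add, h]
  simp only [smul_smul, ← Finset.sum_smul]
  congr 1
  simp [PiLp.inner_apply, Finset.mul_sum]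
  exact Finset.sum_congr rfl fun i _ => by ring

theorem cliffordMap_self (hP : IsCliffordSystem P) (p : EuclideanSpace ℝ (Fin (m + 1)))
    (x : EuclideanSpace ℝ (Fin (2 * l))) :
    cliffordMap P p (cliffordMap P p x) = ‖p‖ ^ 2 • x := by
  have h := cliffordMap_anticomm hP p p x
  rw [← two_smul ℝ, mul_smul, real_inner_self_eq_norm_sq] at h
  exact smul_right_injective _ (two_ne_zero (α := ℝ)) h

theorem inner_cliffordMap_cliffordMap (hP : IsCliffordSystem P)
    (p q : EuclideanSpace ℝ (Fin (m + 1))) (x : EuclideanSpace ℝ (Fin (2 * l))) :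
    ⟪cliffordMap P p x, cliffordMap P q x⟫_ℝ = ⟪p, q⟫_ℝ * ‖x‖ ^ 2 := by
  have h := congrArg (fun y => ⟪x, y⟫_ℝ) (cliffordMap_anticomm hP p q x)
  simp only [inner_add_right, inner_smul_right, real_inner_self_eq_norm_sq] at h
  have a := inner_cliffordMap_left hP p x (cliffordMap P q x)
  have b := inner_cliffordMap_left hP q x (cliffordMap P p x)
  have c := real_inner_comm (cliffordMap P p x) (cliffordMap P q x)
  linarith

theorem norm_cliffordMap_sq (hP : IsCliffordSystem P)
    (p : EuclideanSpace ℝ (Fin (m + 1))) (x : EuclideanSpace ℝ (Fin (2 * l))) :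
    ‖cliffordMap P p x‖ ^ 2 = ‖p‖ ^ 2 * ‖x‖ ^ 2 := by
  rw [← real_inner_self_eq_norm_sq, inner_cliffordMap_cliffordMap hP, real_inner_self_eq_norm_sq]

theorem cliffordForm_cliffordMap_right (hP : IsCliffordSystem P)
    (p : EuclideanSpace ℝ (Fin (m + 1))) (x : EuclideanSpace ℝ (Fin (2 * l))) :
    cliffordForm P x (cliffordMap P p x) = ‖x‖ ^ 2 • p := by
  refine ext_inner_left ℝ fun q => ?_
  rw [inner_cliffordForm, inner_cliffordMap_cliffordMap hP, inner_smul_right, mul_comm]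

/-- The anticommutation rule gives C(p)C(q)C(p) = 2⟨p,q⟩C(p) - ‖p‖²C(q); pair this with x. -/
theorem cliffordForm_cliffordMap_cliffordMap (hP : IsCliffordSystem P)
    (p : EuclideanSpace ℝ (Fin (m + 1))) (x : EuclideanSpace ℝ (Fin (2 * l))) :
    cliffordForm P (cliffordMap P p x) (cliffordMap P p x) =
      (2 * ⟪p, cliffordForm P x x⟫_ℝ) • p - ‖p‖ ^ 2 • cliffordForm P x x := by
  refine ext_inner_left ℝ fun q => ?_
  have h := eq_sub_of_add_eq (cliffordMap_anticomm hP q p x)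
  rw [inner_cliffordForm, h, inner_sub_left, inner_sub_right, inner_smul_left, inner_smul_right,
    inner_smul_right, inner_cliffordMap_left hP p, cliffordMap_self hP, inner_smul_right,
    inner_cliffordForm, inner_cliffordForm, real_inner_comm (cliffordMap P p x)]
  simp
  ring

/-- The symmetric part of `C r ∘ C p ∘ C q` for `q ⊥ p`. -/
theorem cliffordForm_cliffordMap_comp (hP : IsCliffordSystem P)
    {p q : EuclideanSpace ℝ (Fin (m + 1))} (hpq : ⟪p, q⟫_ℝ = 0)
    (x : EuclideanSpace ℝ (Fin (2 * l))) :
    cliffordForm P x (cliffordMap P p (cliffordMap P q x)) =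
      ⟪q, cliffordForm P x x⟫_ℝ • p - ⟪p, cliffordForm P x x⟫_ℝ • q := by
  refine ext_inner_left ℝ fun r => ?_
  have h1 : cliffordMap P r (cliffordMap P p (cliffordMap P q x)) +
      cliffordMap P q (cliffordMap P p (cliffordMap P r x)) =
      (2 * ⟪r, p⟫_ℝ) • cliffordMap P q x - (2 * ⟪r, q⟫_ℝ) • cliffordMap P p x := by
    have a := cliffordMap_anticomm hP r p (cliffordMap P q x)
    have b := cliffordMap_anticomm hP r q x
    have c := cliffordMap_anticomm hP p q (cliffordMap P r x)
    have b' := congrArg (cliffordMap P p) b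
    simp only [map_add, map_smul] at b'
    rw [hpq] at c
    rw [← a, ← b']
    simp only [mul_zero, zero_smul] at c
    rw [eq_neg_of_add_eq_zero_right c]
    abel
  have h2 := congrArg (fun y => ⟪x, y⟫_ℝ) h1
  -- The two triple products in `h1` are adjoint to each other, so paired with x they contribute
  -- equally.
  simp only [inner_add_right, inner_sub_right, inner_smul_right, ← inner_cliffordMap_left hP] at h2
  have h3 : ⟪cliffordMap P p (cliffordMap P q x), cliffordMap P r x⟫_ℝ =
    ⟪cliffordMap P p (cliffordMap P r x), cliffordMap P q x⟫_ℝ := by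
      rw [inner_cliffordMap_left hP, real_inner_comm]
  rw [inner_cliffordForm, inner_sub_right, inner_smul_right, inner_smul_right,
    inner_cliffordForm, inner_cliffordForm]
  simp only [inner_cliffordMap_left hP] at h2 h3 ⊢
  have h4 := real_inner_comm (cliffordMap P p x) (cliffordMap P r x)
  linarith

/-- Cauchy–Schwarz for ‖B(x,x)‖² = ⟨C(B(x,x))x, x⟩. It yields F ≥ -1 on the unit sphere. -/
theorem cliffordForm_self_norm_le (hP : IsCliffordSystem P) (x : EuclideanSpace ℝ (Fin (2 * l))) :
    ‖cliffordForm P x x‖ ≤ ‖x‖ ^ 2 := by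
  have h := real_inner_le_norm (cliffordMap P (cliffordForm P x x) x) x
  rw [← inner_cliffordForm, real_inner_self_eq_norm_sq] at h
  have h2 : ‖cliffordMap P (cliffordForm P x x) x‖ = ‖cliffordForm P x x‖ * ‖x‖ := by
    rw [← sq_eq_sq₀ (by positivity) (by positivity), norm_cliffordMap_sq hP]; ring
  rw [h2] at h
  by_contra! hc
  nlinarith [norm_nonneg (cliffordForm P x x), sq_nonneg ‖x‖]

theorem exists_orthogonal_unit (hm : 0 < m) (p : EuclideanSpace ℝ (Fin (m + 1))) :
    ∃ q : EuclideanSpace ℝ (Fin (m + 1)), ‖q‖ = 1 ∧ ⟪p, q⟫_ℝ = 0 := by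
  have h := (ℝ ∙ p).finrank_add_finrank_orthogonal
  have h1 := finrank_span_le_card (R := ℝ) ({p} : Set (EuclideanSpace ℝ (Fin (m + 1))))
  simp at h h1
  have : Nontrivial (ℝ ∙ p)ᗮ := Module.nontrivial_of_finrank_pos (R := ℝ) (by omega)
  obtain ⟨q, hq⟩ := exists_norm_eq (ℝ ∙ p)ᗮ zero_le_one
  exact ⟨q, by simpa using hq, Submodule.mem_orthogonal_singleton_iff_inner_right.1 q.2⟩

/-- Conjugation by C(q), for a unit q ⊥ p, turns C(p) into -C(p). Such a q exists because m ≥ 1. -/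
theorem trace_cliffordMap (hm : 0 < m) (hP : IsCliffordSystem P)
    (p : EuclideanSpace ℝ (Fin (m + 1))) :
    LinearMap.trace ℝ _ (cliffordMap P p) = 0 := by
  obtain ⟨q, hq, hpq⟩ := exists_orthogonal_unit hm p
  have h1 : cliffordMap P q ∘ₗ cliffordMap P q = LinearMap.id := by
    ext1 x; simp [cliffordMap_self hP, hq]
  have h2 : cliffordMap P q ∘ₗ cliffordMap P p = - (cliffordMap P p ∘ₗ cliffordMap P q) := by
    ext1 x
    have := cliffordMap_anticomm hP q p x
    rw [real_inner_comm, hpq] at this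
    simpa using eq_neg_of_add_eq_zero_left (by simpa using this)
  have h3 := LinearMap.trace_comp_comm' (cliffordMap P q ∘ₗ cliffordMap P p) (cliffordMap P q)
  rw [← LinearMap.comp_assoc, h1, LinearMap.id_comp, h2, LinearMap.neg_comp, LinearMap.comp_assoc,
    h1, LinearMap.comp_id, map_neg] at h3
  linarith

/-- The projection (Id + C(p))/2 onto the eigenspace has trace 2l/2, which is its rank. -/
theorem finrank_eigenspace_cliffordMap (hm : 0 < m) (hP : IsCliffordSystem P)
    {p : EuclideanSpace ℝ (Fin (m + 1))} (hp : ‖p‖ = 1) :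
    Module.finrank ℝ (Module.End.eigenspace (cliffordMap P p) 1) = l := by
  have h : LinearMap.IsProj (Module.End.eigenspace (cliffordMap P p) 1)
      ((1 / 2 : ℝ) • (LinearMap.id + cliffordMap P p)) := by
    refine ⟨fun x => ?_, fun x hx => ?_⟩
    · rw [Module.End.mem_eigenspace_iff]
      simp [cliffordMap_self hP, hp]
      abel
    · rw [Module.End.mem_eigenspace_iff] at hx
      simp [hx]
      module
  have := h.trace
  rw [map_smul, map_add, trace_cliffordMap hm hP, LinearMap.trace_id] at this
  simp at this
  exact_mod_cast this.symm

/-- The vectors of the `1`-eigenspace of `C p` that are orthogonal to all `Pᵢ x`. -/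
noncomputable def transverseEigenspace
    (P : Fin (m + 1) → EuclideanSpace ℝ (Fin (2 * l)) →ₗ[ℝ] EuclideanSpace ℝ (Fin (2 * l)))
    (p : EuclideanSpace ℝ (Fin (m + 1))) (x : EuclideanSpace ℝ (Fin (2 * l))) :
    Submodule ℝ (EuclideanSpace ℝ (Fin (2 * l))) :=
  Module.End.eigenspace (cliffordMap P p) 1 ⊓ (cliffordForm P x).ker

theorem mem_transverseEigenspace {p : EuclideanSpace ℝ (Fin (m + 1))}
    {x v : EuclideanSpace ℝ (Fin (2 * l))} :
    v ∈ transverseEigenspace P p x ↔ cliffordMap P p v = v ∧ cliffordForm P x v = 0 := by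
  simp [transverseEigenspace]

/-- Rank–nullity for B(x,·) on the l-dimensional eigenspace, with values in dimension m+1. -/
theorem le_finrank_transverseEigenspace (hm : 0 < m) (hP : IsCliffordSystem P)
    {p : EuclideanSpace ℝ (Fin (m + 1))} (hp : ‖p‖ = 1) (x : EuclideanSpace ℝ (Fin (2 * l))) :
    l ≤ Module.finrank ℝ (transverseEigenspace P p x) + (m + 1) := by
  have h1 := ((cliffordForm P x).domRestrict
    (Module.End.eigenspace (cliffordMap P p) 1)).finrank_range_add_finrank_ker
  rw [finrank_eigenspace_cliffordMap hm hP hp, LinearMap.ker_domRestrict] at h1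
  have h2 := Submodule.finrank_le ((cliffordForm P x).domRestrict
    (Module.End.eigenspace (cliffordMap P p) 1)).range
  have h3 : Module.finrank ℝ ((cliffordForm P x).ker.submoduleOf
      (Module.End.eigenspace (cliffordMap P p) 1)) = Module.finrank ℝ (transverseEigenspace P p x) := by
    rw [transverseEigenspace, ← Submodule.map_comap_subtype, Submodule.finrank_map_subtype_eq]
    rfl
  simp at h2
  have h4 : Module.finrank ℝ (Submodule.comap (Module.End.eigenspace (cliffordMap P p) 1).subtype
    (cliffordForm P x).ker) = Module.finrank ℝ (transverseEigenspace P p x) := h3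
  omega

end Clifford

/-! ### Gradient, Hessian and Laplacian of the quartic -/

section Calculus

variable {l m : ℕ}
  {P : Fin (m + 1) → EuclideanSpace ℝ (Fin (2 * l)) →ₗ[ℝ] EuclideanSpace ℝ (Fin (2 * l))}

/-- The gradient field of the quartic. -/
noncomputable def quarticGradient
    (P : Fin (m + 1) → EuclideanSpace ℝ (Fin (2 * l)) →ₗ[ℝ] EuclideanSpace ℝ (Fin (2 * l)))
    (x : EuclideanSpace ℝ (Fin (2 * l))) : EuclideanSpace ℝ (Fin (2 * l)) :=
  (4 * ⟪x, x⟫_ℝ) • x - (8 : ℝ) • ∑ i, ⟪P i x, x⟫_ℝ • P i x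

theorem quarticGradient_eq (x : EuclideanSpace ℝ (Fin (2 * l))) :
    quarticGradient P x =
      (4 * ‖x‖ ^ 2) • x - (8 : ℝ) • cliffordMap P (cliffordForm P x x) x := by
  rw [quarticGradient, cliffordMap_cliffordForm, real_inner_self_eq_norm_sq]

theorem LinearMap.contDiff_of_finiteDimensional {E F : Type*} [NormedAddCommGroup E]
    [NormedSpace ℝ E] [FiniteDimensional ℝ E] [NormedAddCommGroup F] [NormedSpace ℝ F]
    (f : E →ₗ[ℝ] F) {n : WithTop ℕ∞} : ContDiff ℝ n f :=
  f.toContinuousLinearMap.contDiff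

theorem LinearMap.hasFDerivAt_toContinuousLinearMap {E F : Type*} [NormedAddCommGroup E]
    [NormedSpace ℝ E] [FiniteDimensional ℝ E] [NormedAddCommGroup F] [NormedSpace ℝ F]
    (f : E →ₗ[ℝ] F) (x : E) : HasFDerivAt f f.toContinuousLinearMap x :=
  f.toContinuousLinearMap.hasFDerivAt

theorem contDiff_cliffordQuartic : ContDiff ℝ ∞ (cliffordQuartic P) := by
  have h : ∀ i, ContDiff ℝ ∞ (P i) := fun i => (P i).contDiff_of_finiteDimensional
  exact ((contDiff_id.inner ℝ contDiff_id).pow 2).sub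
    (contDiff_const.mul (ContDiff.sum fun i _ => ((h i).inner ℝ contDiff_id).pow 2))

theorem contDiff_quarticGradient : ContDiff ℝ ∞ (quarticGradient P) := by
  have h : ∀ i, ContDiff ℝ ∞ (P i) := fun i => (P i).contDiff_of_finiteDimensional
  have hs : ContDiff ℝ ∞ fun y => ∑ i, ⟪P i y, y⟫_ℝ • P i y :=
    ContDiff.sum fun i _ => ((h i).inner ℝ contDiff_id).smul (h i)
  exact ((contDiff_const.mul (contDiff_id.inner ℝ contDiff_id)).smul contDiff_id).sub
    (hs.const_smul (8 : ℝ))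

theorem hasGradientAt_cliffordQuartic (hP : IsCliffordSystem P)
    (x : EuclideanSpace ℝ (Fin (2 * l))) :
    HasGradientAt (cliffordQuartic P) (quarticGradient P x) x := by
  have hq : ∀ i, HasFDerivAt (fun y => ⟪P i y, y⟫_ℝ) _ x := fun i =>
    ((P i).hasFDerivAt_toContinuousLinearMap x).inner ℝ (hasFDerivAt_id x)
  have hs := HasFDerivAt.fun_sum fun i (_ : i ∈ Finset.univ) => (hq i).pow 2
  have h := ((((hasFDerivAt_id x).inner ℝ (hasFDerivAt_id x)).pow 2).sub (hs.const_mul 2))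
  rw [hasGradientAt_iff_hasFDerivAt]
  refine h.congr_fderiv ?_
  ext v
  have hsym : ∀ i, ⟪P i v, x⟫_ℝ = ⟪P i x, v⟫_ℝ := fun i => by
    rw [hP.symmetric, real_inner_comm]
  simp [quarticGradient, fderivInnerCLM_apply, hsym,
    real_inner_comm x v, Finset.mul_sum]
  refine congrArg₂ _ (by ring) (Finset.sum_congr rfl fun i _ => by ring)

theorem gradient_cliffordQuartic (hP : IsCliffordSystem P) :
    ∇ (cliffordQuartic P) = quarticGradient P :=
  funext fun x => (hasGradientAt_cliffordQuartic hP x).gradient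

theorem hasFDerivAt_quarticGradient (hP : IsCliffordSystem P)
    (x : EuclideanSpace ℝ (Fin (2 * l))) :
    ∃ H : EuclideanSpace ℝ (Fin (2 * l)) →L[ℝ] EuclideanSpace ℝ (Fin (2 * l)),
      HasFDerivAt (quarticGradient P) H x ∧ ∀ v, H v = (8 * ⟪x, v⟫_ℝ) • x + (4 * ‖x‖ ^ 2) • v -
        (16 : ℝ) • cliffordMap P (cliffordForm P x v) x -
        (8 : ℝ) • cliffordMap P (cliffordForm P x x) v := by
  have hq : ∀ i, HasFDerivAt (fun y => ⟪P i y, y⟫_ℝ) _ x := fun i =>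
    ((P i).hasFDerivAt_toContinuousLinearMap x).inner ℝ (hasFDerivAt_id x)
  have hs := HasFDerivAt.fun_sum fun i (_ : i ∈ Finset.univ) =>
    (hq i).smul ((P i).hasFDerivAt_toContinuousLinearMap x)
  have h := ((((hasFDerivAt_id x).inner ℝ (hasFDerivAt_id x)).const_mul 4).smul
    (hasFDerivAt_id x)).sub (hs.const_smul (8 : ℝ))
  refine ⟨_, h, fun v => ?_⟩
  have hsym : ∀ i, ⟪P i v, x⟫_ℝ = ⟪P i x, v⟫_ℝ := fun i => by
    rw [hP.symmetric, real_inner_comm]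
  simp only [cliffordMap_cliffordForm]
  simp [fderivInnerCLM_apply, hsym, real_inner_comm x v, Finset.sum_add_distrib, add_smul,
    Finset.smul_sum, smul_smul]
  -- The derivative of B(x,x) is 2B(x,v), which the product rule delivers as two equal sums.
  have e : ∑ i, (16 * ⟪P i x, v⟫_ℝ) • P i x =
      ∑ i, (8 * ⟪P i x, v⟫_ℝ) • P i x + ∑ i, (8 * ⟪P i x, v⟫_ℝ) • P i x := by
    rw [← Finset.sum_add_distrib]
    exact Finset.sum_congr rfl fun i _ => by module
  rw [e]
  module

theorem norm_quarticGradient_sq (hP : IsCliffordSystem P) (x : EuclideanSpace ℝ (Fin (2 * l))) :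
    ‖quarticGradient P x‖ ^ 2 = 16 * ‖x‖ ^ 6 := by
  rw [quarticGradient_eq, norm_sub_sq_real, norm_smul, norm_smul, mul_pow, mul_pow,
    norm_cliffordMap_sq hP, inner_smul_left, inner_smul_right, real_inner_comm,
    ← inner_cliffordForm, real_inner_self_eq_norm_sq]
  simp
  ring

/-- The four terms of the Hessian have traces 8‖x‖², 8l‖x‖², -16(m+1)‖x‖² and 0. The third uses that
each Pᵢ is an isometry. -/
theorem laplacian_cliffordQuartic (hm : 0 < m) (hP : IsCliffordSystem P)
    (x : EuclideanSpace ℝ (Fin (2 * l))) :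
    Δ (cliffordQuartic P) x = 8 * ((l : ℝ) - 2 * m - 1) * ‖x‖ ^ 2 := by
  obtain ⟨H, hH, hHv⟩ := hasFDerivAt_quarticGradient hP x
  have h1 : fderiv ℝ (cliffordQuartic P) = fun y => innerSL ℝ (quarticGradient P y) := by
    ext1 y
    exact (hasGradientAt_cliffordQuartic hP y).hasFDerivAt.fderiv
  have h2 : ∀ v w, fderiv ℝ (fderiv ℝ (cliffordQuartic P)) x v w = ⟪H v, w⟫_ℝ := fun v w => by
    have h3 : HasFDerivAt (fun y => innerSL ℝ (quarticGradient P y)) _ x :=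
      (innerSL ℝ).hasFDerivAt.comp x hH
    rw [h1, h3.fderiv]
    rfl
  set b := stdOrthonormalBasis ℝ (EuclideanSpace ℝ (Fin (2 * l)))
  have hB : ∑ i, ⟪b i, cliffordMap P (cliffordForm P x x) (b i)⟫_ℝ = 0 := by
    rw [← LinearMap.trace_eq_sum_inner, trace_cliffordMap hm hP]
  have hx : ∑ i, ⟪x, b i⟫_ℝ * ⟪x, b i⟫_ℝ = ‖x‖ ^ 2 := by
    have := b.sum_sq_inner_left x
    simpa [sq] using this
  have hc : ∑ i, ⟪cliffordMap P (cliffordForm P x (b i)) x, b i⟫_ℝ = (m + 1) * ‖x‖ ^ 2 := by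
    have : ∀ j, ∑ i, ⟪P j x, b i⟫_ℝ * ⟪P j x, b i⟫_ℝ = ‖x‖ ^ 2 := fun j => by
      have h := b.sum_sq_inner_left (P j x)
      have h' := norm_cliffordMap_sq hP (EuclideanSpace.single j 1) x
      simp [cliffordMap_apply] at h'
      rw [← h', ← h]
      exact Finset.sum_congr rfl fun i _ => (sq _).symm
    simp only [cliffordMap_cliffordForm, sum_inner, inner_smul_left]
    rw [Finset.sum_comm]
    simp [this]
  rw [InnerProductSpace.laplacian_eq_iteratedFDeriv_orthonormalBasis _ b]
  simp only [iteratedFDeriv_two_apply, h2, hHv, Matrix.cons_val_zero, Matrix.cons_val_one,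
    inner_sub_left, inner_add_left, inner_smul_left, Finset.sum_sub_distrib,
    Finset.sum_add_distrib, conj_trivial]
  have e1 : ∑ i, 8 * ⟪x, b i⟫_ℝ * ⟪x, b i⟫_ℝ = 8 * ‖x‖ ^ 2 := by
    rw [← hx, Finset.mul_sum]; simp [mul_assoc]
  rw [e1, ← Finset.mul_sum, ← Finset.mul_sum, ← Finset.mul_sum, hc]
  simp only [inner_cliffordMap_left hP, hB]
  simp
  ring

end Calculus

/-! ### Normal frames and the normal great circles -/

section Frame

variable {l m : ℕ}
  {P : Fin (m + 1) → EuclideanSpace ℝ (Fin (2 * l)) →ₗ[ℝ] EuclideanSpace ℝ (Fin (2 * l))}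

/-- A point `x` of the unit sphere at signed distance `τ` from the focal level `F = 1`, with a unit
normal vector `ξ` and the element `p` of the Clifford sphere that preserves the plane of
`x` and `ξ`. -/
structure IsNormalFrame
    (P : Fin (m + 1) → EuclideanSpace ℝ (Fin (2 * l)) →ₗ[ℝ] EuclideanSpace ℝ (Fin (2 * l)))
    (τ : ℝ) (p : EuclideanSpace ℝ (Fin (m + 1))) (x ξ : EuclideanSpace ℝ (Fin (2 * l))) :
    Prop where
  norm_index : ‖p‖ = 1
  norm_point : ‖x‖ = 1
  norm_normal : ‖ξ‖ = 1
  inner_eq : ⟪x, ξ⟫_ℝ = 0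
  form_point : cliffordForm P x x = Real.sin (2 * τ) • p
  form_mixed : cliffordForm P x ξ = -Real.cos (2 * τ) • p
  form_normal : cliffordForm P ξ ξ = -Real.sin (2 * τ) • p

namespace IsNormalFrame

variable {τ : ℝ} {p : EuclideanSpace ℝ (Fin (m + 1))} {x ξ : EuclideanSpace ℝ (Fin (2 * l))}

/-- A traceless symmetric form on a plane turns through twice the angle by which the basis is
rotated. -/
theorem rotate (hP : IsCliffordSystem P) (h : IsNormalFrame P τ p x ξ) (ε : ℝ) :
    IsNormalFrame P (τ - ε) p (Real.cos ε • x + Real.sin ε • ξ)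
      (-Real.sin ε • x + Real.cos ε • ξ) := by
  have hx : ⟪x, x⟫_ℝ = 1 := by rw [real_inner_self_eq_norm_sq, h.norm_point, one_pow]
  have hξ : ⟪ξ, ξ⟫_ℝ = 1 := by rw [real_inner_self_eq_norm_sq, h.norm_normal, one_pow]
  have hξx : ⟪ξ, x⟫_ℝ = 0 := by rw [real_inner_comm, h.inner_eq]
  have hB : cliffordForm P ξ x = -Real.cos (2 * τ) • p := by
    rw [cliffordForm_comm hP, h.form_mixed]
  have hcs := Real.sin_sq_add_cos_sq ε
  have hs : Real.sin (2 * (τ - ε)) = Real.sin (2 * τ) * (2 * Real.cos ε ^ 2 - 1) -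
      Real.cos (2 * τ) * (2 * Real.sin ε * Real.cos ε) := by
    rw [mul_sub, Real.sin_sub, Real.cos_two_mul ε, Real.sin_two_mul ε]
  have hc : Real.cos (2 * (τ - ε)) = Real.cos (2 * τ) * (2 * Real.cos ε ^ 2 - 1) +
      Real.sin (2 * τ) * (2 * Real.sin ε * Real.cos ε) := by
    rw [mul_sub, Real.cos_sub, Real.cos_two_mul ε, Real.sin_two_mul ε]
  have key : ∀ a b : ℝ, a ^ 2 + b ^ 2 = 1 → ‖a • x + b • ξ‖ = 1 := fun a b hab => by
    rw [← sq_eq_sq₀ (norm_nonneg _) zero_le_one, ← real_inner_self_eq_norm_sq]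
    simp only [inner_add_left, inner_add_right, inner_smul_left, inner_smul_right, hx, hξ, hξx,
      h.inner_eq, conj_trivial]
    linear_combination hab
  refine ⟨h.norm_index, key _ _ (by linarith), key _ _ (by linarith), ?_, ?_, ?_, ?_⟩
  · simp only [inner_add_left, inner_add_right, inner_smul_left, inner_smul_right, hx, hξ, hξx,
      h.inner_eq, conj_trivial]
    ring
  all_goals
    simp only [map_add, map_smul, LinearMap.add_apply, LinearMap.smul_apply, h.form_point,
      h.form_mixed, h.form_normal, hB, smul_smul, ← add_smul, hs, hc]
    congr 1
  · linear_combination -Real.sin (2 * τ) * hcs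
  · linear_combination Real.cos (2 * τ) * hcs
  · linear_combination Real.sin (2 * τ) * hcs

/-- The unit vector C(p)x has components sin 2τ and -cos 2τ along x and ξ. Their squares already add
up to 1, so nothing is left outside the plane. -/
theorem cliffordMap_point (hP : IsCliffordSystem P) (h : IsNormalFrame P τ p x ξ) :
    cliffordMap P p x = Real.sin (2 * τ) • x - Real.cos (2 * τ) • ξ := by
  have hpp : ⟪p, p⟫_ℝ = 1 := by rw [real_inner_self_eq_norm_sq, h.norm_index, one_pow]
  have h1 : ⟪cliffordMap P p x, x⟫_ℝ = Real.sin (2 * τ) := by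
    rw [← inner_cliffordForm, h.form_point, inner_smul_right, hpp, mul_one]
  have h2 : ⟪cliffordMap P p x, ξ⟫_ℝ = -Real.cos (2 * τ) := by
    rw [← inner_cliffordForm, h.form_mixed, inner_smul_right, hpp, mul_one]
  rw [← sub_eq_zero, ← norm_eq_zero, ← sq_eq_zero_iff, norm_sub_sq_real, norm_sub_sq_real,
    norm_cliffordMap_sq hP, norm_smul, norm_smul, mul_pow, mul_pow, inner_sub_right,
    inner_smul_right, inner_smul_right, inner_smul_left, inner_smul_right, h1, h2, h.inner_eq,
    h.norm_index, h.norm_point, h.norm_normal, Real.norm_eq_abs, Real.norm_eq_abs, sq_abs, sq_abs]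
  linear_combination -Real.sin_sq_add_cos_sq (2 * τ)

theorem cliffordMap_normal (hP : IsCliffordSystem P) (h : IsNormalFrame P τ p x ξ) :
    cliffordMap P p ξ = -Real.cos (2 * τ) • x - Real.sin (2 * τ) • ξ := by
  -- A quarter turn makes ξ the base point of a frame with normal -x.
  have h1 := (h.rotate hP (Real.pi / 2)).cliffordMap_point hP
  have e : 2 * (τ - Real.pi / 2) = 2 * τ - Real.pi := by ring
  simp only [Real.cos_pi_div_two, Real.sin_pi_div_two, e, Real.sin_sub_pi, Real.cos_sub_pi] at h1
  simp at h1
  rw [h1]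
  module

theorem quartic_eq (h : IsNormalFrame P τ p x ξ) : cliffordQuartic P x = Real.cos (4 * τ) := by
  rw [cliffordQuartic_eq, h.form_point, norm_smul, h.norm_index, h.norm_point, Real.norm_eq_abs,
    mul_one, sq_abs, show 4 * τ = 2 * (2 * τ) by ring, Real.cos_two_mul, Real.cos_sq']
  ring

theorem mem_sphereLevel (h : IsNormalFrame P τ p x ξ) :
    x ∈ sphereLevel (cliffordQuartic P) (Real.cos (4 * τ)) :=
  ⟨by simp [h.norm_point], h.quartic_eq⟩

end IsNormalFrame

theorem sphereGradient_cliffordQuartic (hP : IsCliffordSystem P)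
    (x : EuclideanSpace ℝ (Fin (2 * l))) :
    sphereGradient (cliffordQuartic P) x =
      quarticGradient P x - (4 * cliffordQuartic P x) • x := by
  rw [sphereGradient, gradient_cliffordQuartic hP]
  congr 2
  rw [quarticGradient_eq, inner_sub_left, inner_smul_left, inner_smul_left, ← inner_cliffordForm,
    real_inner_self_eq_norm_sq, real_inner_self_eq_norm_sq, cliffordQuartic_eq, conj_trivial,
    conj_trivial]
  ring

theorem IsNormalFrame.sphereGradient_eq (hP : IsCliffordSystem P) {τ : ℝ}
    {p : EuclideanSpace ℝ (Fin (m + 1))} {x ξ : EuclideanSpace ℝ (Fin (2 * l))}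
    (h : IsNormalFrame P τ p x ξ) :
    sphereGradient (cliffordQuartic P) x = (4 * Real.sin (4 * τ)) • ξ := by
  rw [sphereGradient_cliffordQuartic hP, quarticGradient_eq, h.quartic_eq, h.form_point, map_smul,
    LinearMap.smul_apply, h.cliffordMap_point hP, h.norm_point,
    show 4 * τ = 2 * (2 * τ) by ring, Real.cos_two_mul (2 * τ), Real.cos_sq' (2 * τ),
    Real.sin_two_mul (2 * τ)]
  module

theorem IsNormalFrame.unitSphereGradient_eq (hP : IsCliffordSystem P) {τ : ℝ}
    {p : EuclideanSpace ℝ (Fin (m + 1))} {x ξ : EuclideanSpace ℝ (Fin (2 * l))}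
    (h : IsNormalFrame P τ p x ξ) (hτ : 0 < Real.sin (4 * τ)) :
    unitSphereGradient (cliffordQuartic P) x = ξ := by
  rw [unitSphereGradient, h.sphereGradient_eq hP, norm_smul, h.norm_normal, smul_smul, mul_one,
    Real.norm_of_nonneg (by positivity), inv_mul_cancel₀ (by positivity), one_smul]

/-- Every point of the sphere extends to a normal frame. -/
theorem exists_isNormalFrame (hm : 0 < m) (hlm : m + 1 < l) (hP : IsCliffordSystem P) {τ : ℝ}
    {x : EuclideanSpace ℝ (Fin (2 * l))}
    (hx : x ∈ sphereLevel (cliffordQuartic P) (Real.cos (4 * τ))) :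
    ∃ p ξ, IsNormalFrame P τ p x ξ := by
  obtain ⟨hx1, hF⟩ := hx
  have hx1 : ‖x‖ = 1 := by simpa using hx1
  have hcs := Real.sin_sq_add_cos_sq (2 * τ)
  have hn : ‖cliffordForm P x x‖ ^ 2 = Real.sin (2 * τ) ^ 2 := by
    rw [cliffordQuartic_eq, hx1, show 4 * τ = 2 * (2 * τ) by ring, Real.cos_two_mul,
      Real.cos_sq'] at hF
    linarith
  obtain ⟨p, hp, hB⟩ : ∃ p : EuclideanSpace ℝ (Fin (m + 1)), ‖p‖ = 1 ∧
      cliffordForm P x x = Real.sin (2 * τ) • p := by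
    rcases eq_or_ne (Real.sin (2 * τ)) 0 with h0 | h0
    -- On the focal level F = 1, B(x,x) vanishes and any unit p will do.
    · refine ⟨EuclideanSpace.single 0 1, by simp, ?_⟩
      rw [h0] at hn ⊢
      simpa using hn
    · refine ⟨(Real.sin (2 * τ))⁻¹ • cliffordForm P x x, ?_, by rw [smul_inv_smul₀ h0]⟩
      rw [← sq_eq_sq₀ (norm_nonneg _) zero_le_one, norm_smul, mul_pow, hn, norm_inv,
        Real.norm_eq_abs, inv_pow, sq_abs, inv_mul_cancel₀ (pow_ne_zero 2 h0), one_pow]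
  have hpp : ⟪p, p⟫_ℝ = 1 := by rw [real_inner_self_eq_norm_sq, hp, one_pow]
  have hpx : ⟪cliffordMap P p x, x⟫_ℝ = Real.sin (2 * τ) := by
    rw [← inner_cliffordForm, hB, inner_smul_right, hpp, mul_one]
  have hpn : ‖cliffordMap P p x‖ ^ 2 = 1 := by rw [norm_cliffordMap_sq hP, hp, hx1]; norm_num
  rcases eq_or_ne (Real.cos (2 * τ)) 0 with h0 | h0
  -- On the focal level F = -1, x is an eigenvector of C(p) and does not determine ξ. Any unit ξ in
  -- the opposite eigenspace with B(x,ξ) = 0 works; one exists because l-m-1 > 0.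
  · have hs : Real.sin (2 * τ) ^ 2 = 1 := by rw [h0] at hcs; linarith
    have hs' : ‖-Real.sin (2 * τ) • p‖ = 1 := by
      rw [← sq_eq_sq₀ (norm_nonneg _) zero_le_one, norm_smul, mul_pow, hp, norm_neg,
        Real.norm_eq_abs, sq_abs, hs]
      norm_num
    have hd := le_finrank_transverseEigenspace hm hP hs' x
    have : Nontrivial (transverseEigenspace P (-Real.sin (2 * τ) • p) x) :=
      Module.nontrivial_of_finrank_pos (R := ℝ) (by omega)
    obtain ⟨⟨ξ, hξ⟩, hξ1⟩ := exists_norm_eq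
      (transverseEigenspace P (-Real.sin (2 * τ) • p) x) zero_le_one
    obtain ⟨hξp, hξx⟩ := mem_transverseEigenspace.1 hξ
    have hξ1 : ‖ξ‖ = 1 := hξ1
    have hpξ : cliffordMap P p ξ = -Real.sin (2 * τ) • ξ := by
      have := congrArg (fun v => -Real.sin (2 * τ) • v) hξp
      simp only [map_smul, LinearMap.smul_apply, smul_smul] at this
      rwa [neg_mul_neg, ← sq, hs, one_smul] at this
    have hpx' : cliffordMap P p x = Real.sin (2 * τ) • x := by
      rw [← sub_eq_zero, ← norm_eq_zero, ← sq_eq_zero_iff, norm_sub_sq_real, hpn,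
        inner_smul_right, hpx, norm_smul, mul_pow, hx1, Real.norm_eq_abs, sq_abs]
      linear_combination -hs
    refine ⟨p, ξ, hp, hx1, hξ1, ?_, hB, ?_, ?_⟩
    · have h1 : ⟪cliffordMap P p x, ξ⟫_ℝ = 0 := by
        rw [← inner_cliffordForm, hξx, inner_zero_right]
      rw [hpx', inner_smul_left, conj_trivial] at h1
      refine (mul_eq_zero.1 h1).resolve_left fun h2 => ?_
      rw [h2] at hs
      norm_num at hs
    · rw [hξx, h0]; simp
    -- As C(p)ξ = ±ξ, the left side is B(ξ,ξ) itself, and the identity reads 2B(ξ,ξ) = -2 sin(2τ) p.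
    · have h1 := cliffordForm_cliffordMap_cliffordMap hP p ξ
      rw [inner_cliffordForm, hpξ, hp, inner_smul_left, real_inner_self_eq_norm_sq, hξ1] at h1
      simp only [map_smul, LinearMap.smul_apply, smul_smul, ← sq, neg_sq, hs] at h1
      have h2 : (2 : ℝ) • cliffordForm P ξ ξ = (2 : ℝ) • (-Real.sin (2 * τ) • p) := by
        rw [two_smul]
        nth_rewrite 1 [← one_smul ℝ (cliffordForm P ξ ξ)]
        rw [h1]
        simp
        module
      exact smul_right_injective _ two_ne_zero h2
  · have h1 := cliffordForm_cliffordMap_right hP p x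
    have h2 := cliffordForm_cliffordMap_cliffordMap hP p x
    have h1' : cliffordForm P (cliffordMap P p x) x = p := by
      rw [cliffordForm_comm hP, h1, hx1]; simp
    rw [hx1, one_pow, one_smul] at h1
    rw [hB, inner_smul_right, hpp, mul_one, hp, one_pow, one_smul, ← sub_smul] at h2
    have hc : Real.cos (2 * τ) ^ 2 = 1 - Real.sin (2 * τ) ^ 2 := Real.cos_sq' _
    -- The relation C(p)x = sin(2τ)x - cos(2τ)ξ, forced in any frame, is solved for ξ.
    refine ⟨p, (Real.cos (2 * τ))⁻¹ • (Real.sin (2 * τ) • x - cliffordMap P p x), hp, hx1,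
      ?_, ?_, hB, ?_, ?_⟩
    · rw [← sq_eq_sq₀ (norm_nonneg _) zero_le_one, norm_smul, mul_pow, norm_sub_sq_real, hpn,
        inner_smul_left, real_inner_comm, hpx, norm_smul, mul_pow, hx1, norm_inv,
        Real.norm_eq_abs, Real.norm_eq_abs, inv_pow, sq_abs, sq_abs, conj_trivial]
      field_simp
      linear_combination -hc
    · rw [inner_smul_right, inner_sub_right, inner_smul_right, real_inner_self_eq_norm_sq, hx1,
        real_inner_comm, hpx]
      ring
    · rw [map_smul, map_sub, map_smul, hB, h1, smul_smul]
      have : Real.sin (2 * τ) • Real.sin (2 * τ) • p - p = (-Real.cos (2 * τ) ^ 2) • p := by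
        rw [hc]; module
      rw [← smul_smul, this, smul_smul]
      congr 1
      field_simp
    · simp only [map_smul, map_sub, LinearMap.sub_apply, LinearMap.smul_apply, hB, h1, h1', h2]
      have : ∀ s c : ℝ, c • (s • c • (s • s • p - p) - c • (s • p - (2 * s - s) • p)) =
          (c ^ 2 * (s * (s ^ 2 - 1))) • p := fun s c => by module
      rw [this]
      congr 1
      field_simp
      linear_combination Real.sin (2 * τ) * hc

/-- A unit eigenvector of P₀ has ‖B(x,x)‖ = 1, hence F = -1 and a frame at π/4; rotating that frame
reaches every angle. -/
theorem exists_isNormalFrame_of_angle (hm : 0 < m) (hlm : m + 1 < l) (hP : IsCliffordSystem P)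
    (τ : ℝ) : ∃ p x ξ, IsNormalFrame P τ p x ξ := by
  have hp : ‖(EuclideanSpace.single 0 1 : EuclideanSpace ℝ (Fin (m + 1)))‖ = 1 := by simp
  have hd := finrank_eigenspace_cliffordMap hm hP hp
  have : Nontrivial (Module.End.eigenspace (cliffordMap P (EuclideanSpace.single 0 1)) 1) :=
    Module.nontrivial_of_finrank_pos (R := ℝ) (by omega)
  obtain ⟨⟨x, hx⟩, hx1⟩ := exists_norm_eq
    (Module.End.eigenspace (cliffordMap P (EuclideanSpace.single 0 1)) 1) zero_le_one
  rw [Module.End.mem_eigenspace_iff, one_smul] at hx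
  have hx1 : ‖x‖ = 1 := hx1
  have h1 : ‖cliffordForm P x x‖ = 1 := by
    refine le_antisymm (by simpa [hx1] using cliffordForm_self_norm_le hP x) ?_
    have h := real_inner_le_norm (EuclideanSpace.single 0 1) (cliffordForm P x x)
    rwa [inner_cliffordForm, hx, hp, one_mul, real_inner_self_eq_norm_sq, hx1, one_pow] at h
  obtain ⟨p, ξ, h⟩ := exists_isNormalFrame hm hlm hP (τ := Real.pi / 4) (x := x)
    ⟨by simp [hx1], by
      rw [cliffordQuartic_eq, h1, hx1, show 4 * (Real.pi / 4) = Real.pi by ring, Real.cos_pi]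
      norm_num⟩
  refine ⟨p, _, _, by simpa using h.rotate hP (Real.pi / 4 - τ)⟩

end Frame

/-! ### Eigenspaces and the shape operator in general -/

section Eigenspaces

theorem Module.End.sum_finrank_eigenspace_le {V : Type*} [AddCommGroup V] [Module ℝ V]
    [FiniteDimensional ℝ V] (A : Module.End ℝ V) {ι : Type*} [Fintype ι] {κ : ι → ℝ}
    (hκ : Function.Injective κ) :
    ∑ i, Module.finrank ℝ (A.eigenspace (κ i)) ≤ Module.finrank ℝ V := by
  classical
  rw [← Module.finrank_directSum]
  exact LinearMap.finrank_le_finrank_of_injective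
    (A.eigenspaces_iSupIndep.comp hκ).dfinsupp_lsum_injective

/-- Eigenspaces are independent, so their dimensions cannot add up to more than dim V. Lower bounds
that exhaust dim V are therefore sharp, and a further eigenvalue, adjoined through `Option ι`, would
exceed it. -/
theorem Module.End.eigenspaces_of_finrank_le {V : Type*} [AddCommGroup V] [Module ℝ V]
    [FiniteDimensional ℝ V] (A : Module.End ℝ V) {ι : Type*} [Fintype ι] {κ : ι → ℝ}
    (hκ : Function.Injective κ) {d : ι → ℕ}
    (hd : ∀ i, d i ≤ Module.finrank ℝ (A.eigenspace (κ i)))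
    (hV : Module.finrank ℝ V ≤ ∑ i, d i) :
    (∀ i, Module.finrank ℝ (A.eigenspace (κ i)) = d i) ∧
      ∀ r, A.HasEigenvalue r → ∃ i, r = κ i := by
  have hs := A.sum_finrank_eigenspace_le hκ
  have hle := Finset.sum_le_sum fun i (_ : i ∈ Finset.univ) => hd i
  refine ⟨fun i => ((Finset.sum_eq_sum_iff_of_le fun i _ => hd i).1 (by omega) i
    (Finset.mem_univ i)).symm, fun r hr => ?_⟩
  by_contra! hne
  have hinj : Function.Injective (fun o : Option ι => o.elim r κ) := by
    rintro (_ | i) (_ | j) h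
    · rfl
    · exact absurd h (hne j)
    · exact absurd h.symm (hne i)
    · exact congrArg some (hκ h)
  have h1 := A.sum_finrank_eigenspace_le hinj
  rw [Fintype.sum_option] at h1
  have h2 : 0 < Module.finrank ℝ (A.eigenspace r) :=
    Nat.pos_of_ne_zero fun h0 => hr (Submodule.finrank_eq_zero.1 h0)
  change Module.finrank ℝ (A.eigenspace r) + ∑ i, Module.finrank ℝ (A.eigenspace (κ i)) ≤ _ at h1
  omega

/-- The tangential projection kills x and ξ, so the derivative of ξ is needed only modulo their
span. -/
theorem finrank_le_finrank_eigenspace_shapeOperator {n : ℕ}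
    {ξ : EuclideanSpace ℝ (Fin n) → EuclideanSpace ℝ (Fin n)} {x : EuclideanSpace ℝ (Fin n)}
    {κ : ℝ} {K : Submodule ℝ (EuclideanSpace ℝ (Fin n))}
    (hK : ∀ v ∈ K, ⟪x, v⟫_ℝ = 0 ∧ ⟪ξ x, v⟫_ℝ = 0 ∧
      ∃ a b : ℝ, fderiv ℝ ξ x v = -κ • v + (a • x + b • ξ x)) :
    Module.finrank ℝ K ≤ Module.finrank ℝ ((shapeOperator ξ x).eigenspace κ) := by
  have hT : K ≤ hypersurfaceTangentSpace ξ x := fun v hv => by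
    rw [hypersurfaceTangentSpace, Submodule.mem_orthogonal]
    intro u hu
    obtain ⟨a, b, rfl⟩ := Submodule.mem_span_pair.1 hu
    rw [inner_add_left, inner_smul_left, inner_smul_left, (hK v hv).1, (hK v hv).2.1]
    simp
  have hA : ∀ v : K, Submodule.inclusion hT v ∈ (shapeOperator ξ x).eigenspace κ := fun v => by
    obtain ⟨a, b, h⟩ := (hK v v.2).2.2
    have h0 : (hypersurfaceTangentSpace ξ x).orthogonalProjectionOnto (a • x + b • ξ x) = 0 :=
      Submodule.orthogonalProjectionOnto_apply_of_mem_orthogonal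
        (Submodule.le_orthogonal_orthogonal _ (Submodule.mem_span_pair.2 ⟨a, b, rfl⟩))
    have h1 := (hypersurfaceTangentSpace ξ x).orthogonalProjectionOnto_mem_subspace_eq_self
      (Submodule.inclusion hT v)
    rw [Module.End.mem_eigenspace_iff]
    change -(hypersurfaceTangentSpace ξ x).orthogonalProjectionOnto (fderiv ℝ ξ x v) = _
    rw [h, map_add, h0, map_smul, add_zero, neg_smul, neg_neg]
    exact congrArg _ h1
  refine LinearMap.finrank_le_finrank_of_injective
    (f := (Submodule.inclusion hT).codRestrict _ hA) fun v w h => ?_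
  exact Submodule.inclusion_injective hT (congrArg Subtype.val h)

theorem finrank_hypersurfaceTangentSpace_add_two {n : ℕ}
    {ξ : EuclideanSpace ℝ (Fin n) → EuclideanSpace ℝ (Fin n)} {x : EuclideanSpace ℝ (Fin n)}
    (hx : ‖x‖ = 1) (hξ : ‖ξ x‖ = 1) (h : ⟪x, ξ x⟫_ℝ = 0) :
    Module.finrank ℝ (hypersurfaceTangentSpace ξ x) + 2 = n := by
  have ho : Orthonormal ℝ ![x, ξ x] := by
    rw [orthonormal_iff_ite]
    intro i j
    fin_cases i <;> fin_cases j <;>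
      simp [hx, hξ, h, real_inner_comm x (ξ x)]
  have h1 := finrank_span_eq_card ho.linearIndependent
  rw [Matrix.range_cons_cons_empty, Fintype.card_fin] at h1
  have h2 := (Submodule.span ℝ {x, ξ x}).finrank_add_finrank_orthogonal
  rw [h1, finrank_euclideanSpace_fin] at h2
  rw [hypersurfaceTangentSpace]
  omega

end Eigenspaces

/-! ### Principal vectors of a regular level -/

section Curvatures

variable {l m : ℕ}
  {P : Fin (m + 1) → EuclideanSpace ℝ (Fin (2 * l)) →ₗ[ℝ] EuclideanSpace ℝ (Fin (2 * l))}

theorem unitSphereGradient_cliffordQuartic (hP : IsCliffordSystem P) :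
    unitSphereGradient (cliffordQuartic P) =
      fun y => ‖quarticGradient P y - (4 * cliffordQuartic P y) • y‖⁻¹ •
        (quarticGradient P y - (4 * cliffordQuartic P y) • y) :=
  funext fun y => by rw [unitSphereGradient, sphereGradient_cliffordQuartic hP]

namespace IsNormalFrame

variable {t : ℝ} {p : EuclideanSpace ℝ (Fin (m + 1))} {x ξ : EuclideanSpace ℝ (Fin (2 * l))}

/-- Differentiating the normalizing factor gives only a multiple of ξ, and differentiating F in the
term F(x)x only a multiple of x. What remains is the Hessian minus 4F(x)v, divided by 4 sin 4t = 8
sin 2t cos 2t. -/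
theorem fderiv_unitSphereGradient (hP : IsCliffordSystem P) (h : IsNormalFrame P t p x ξ)
    (ht : 0 < Real.sin (4 * t)) {v : EuclideanSpace ℝ (Fin (2 * l))} (hv : ⟪x, v⟫_ℝ = 0) :
    ∃ a b : ℝ, fderiv ℝ (unitSphereGradient (cliffordQuartic P)) x v =
      (Real.sin (2 * t) * Real.cos (2 * t))⁻¹ • (Real.sin (2 * t) ^ 2 • v -
        (2 : ℝ) • cliffordMap P (cliffordForm P x v) x -
        Real.sin (2 * t) • cliffordMap P p v) + (a • x + b • ξ) := by
  obtain ⟨H, hH, hHv⟩ := hasFDerivAt_quarticGradient hP x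
  have hF := (hasGradientAt_cliffordQuartic hP x).hasFDerivAt
  have hg := hH.sub ((hF.const_mul 4).smul (hasFDerivAt_id x))
  have hgx : quarticGradient P x - (4 * cliffordQuartic P x) • x = (4 * Real.sin (4 * t)) • ξ := by
    rw [← sphereGradient_cliffordQuartic hP, h.sphereGradient_eq hP]
  have hgn : ‖quarticGradient P x - (4 * cliffordQuartic P x) • x‖ = 4 * Real.sin (4 * t) := by
    rw [hgx, norm_smul, h.norm_normal, mul_one, Real.norm_of_nonneg (by positivity)]
  have hd : DifferentiableAt ℝ
      (fun y => ‖quarticGradient P y - (4 * cliffordQuartic P y) • y‖⁻¹) x := by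
    refine DifferentiableAt.inv (hg.differentiableAt.norm ℝ ?_) ?_
    · intro h0
      have h0 : quarticGradient P x - (4 * cliffordQuartic P x) • x = 0 := h0
      rw [h0, norm_zero] at hgn
      linarith
    · rw [hgn]; positivity
  have hξ := hd.hasFDerivAt.smul hg
  rw [unitSphereGradient_cliffordQuartic hP]
  have hξ' : HasFDerivAt (fun y => ‖quarticGradient P y - (4 * cliffordQuartic P y) • y‖⁻¹ •
        (quarticGradient P y - (4 * cliffordQuartic P y) • y)) _ x := hξ
  set μ := fderiv ℝ (fun y => ‖quarticGradient P y - (4 * cliffordQuartic P y) • y‖⁻¹) x v with hμ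
  refine ⟨-(4 * Real.sin (4 * t))⁻¹ * (4 * ⟪quarticGradient P x, v⟫_ℝ),
    μ * (4 * Real.sin (4 * t)), ?_⟩
  rw [hξ'.fderiv]
  have e : (Real.sin (2 * t) * Real.cos (2 * t))⁻¹ = (4 * Real.sin (4 * t))⁻¹ * 8 := by
    rw [show 4 * t = 2 * (2 * t) by ring, Real.sin_two_mul (2 * t), mul_assoc 2, mul_inv 4,
      mul_inv 2]
    ring
  have hc : Real.cos (4 * t) = 1 - 2 * Real.sin (2 * t) ^ 2 := by
    rw [show 4 * t = 2 * (2 * t) by ring, Real.cos_two_mul (2 * t), Real.cos_sq' (2 * t)]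
    ring
  change ‖quarticGradient P x - (4 * cliffordQuartic P x) • x‖⁻¹ • (H v -
    ((4 * cliffordQuartic P x) • v + (4 * ⟪quarticGradient P x, v⟫_ℝ) • x)) +
    μ • (quarticGradient P x - (4 * cliffordQuartic P x) • x) = _
  rw [hgn, hgx, hHv, hv, e, h.norm_point, h.form_point, h.quartic_eq, hc, map_smul,
    LinearMap.smul_apply]
  module

/-- The principal vectors on which `C p` is a multiple of the identity. -/
theorem le_finrank_eigenspace_of_transverse (hm : 0 < m) (hP : IsCliffordSystem P)
    (h : IsNormalFrame P t p x ξ) (ht : 0 < Real.sin (4 * t)) {σ : ℝ} (hσ : σ ^ 2 = 1) {κ : ℝ}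
    (hκ : κ * Real.cos (2 * t) = σ - Real.sin (2 * t)) :
    l ≤ Module.finrank ℝ ((shapeOperator (unitSphereGradient (cliffordQuartic P)) x).eigenspace κ)
      + (m + 1) := by
  have hu := h.unitSphereGradient_eq hP ht
  have hsc : Real.sin (2 * t) * Real.cos (2 * t) ≠ 0 := fun h0 => by
    rw [show 4 * t = 2 * (2 * t) by ring, Real.sin_two_mul, mul_assoc, h0] at ht
    simp at ht
  have hσp : ‖σ • p‖ = 1 := by
    rw [← sq_eq_sq₀ (norm_nonneg _) zero_le_one, norm_smul, mul_pow, h.norm_index,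
      Real.norm_eq_abs, sq_abs, hσ]
    norm_num
  refine (le_finrank_transverseEigenspace hm hP hσp x).trans (Nat.add_le_add_right
    (finrank_le_finrank_eigenspace_shapeOperator fun v hv => ?_) _)
  obtain ⟨hv1, hv2⟩ := mem_transverseEigenspace.1 hv
  have hpv : cliffordMap P p v = σ • v := by
    have := congrArg (fun v => σ • v) hv1
    simp only [map_smul, LinearMap.smul_apply, smul_smul] at this
    rwa [← sq, hσ, one_smul] at this
  have hpxv : ⟪cliffordMap P p x, v⟫_ℝ = 0 := by rw [← inner_cliffordForm, hv2, inner_zero_right]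
  have hxv : ⟪x, v⟫_ℝ = 0 := by
    have h1 := hpxv
    rw [inner_cliffordMap_left hP, hpv, inner_smul_right] at h1
    refine (mul_eq_zero.1 h1).resolve_left fun h2 => ?_
    rw [h2] at hσ
    norm_num at hσ
  -- Since cos 2t ≠ 0, ξ is a combination of x and C(p)x, and both are orthogonal to v.
  have hξv : ⟪ξ, v⟫_ℝ = 0 := by
    rw [h.cliffordMap_point hP, inner_sub_left, inner_smul_left, inner_smul_left, hxv] at hpxv
    simpa [right_ne_zero_of_mul hsc] using hpxv
  obtain ⟨a, b, hab⟩ := h.fderiv_unitSphereGradient hP ht hxv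
  refine ⟨hxv, by rw [hu, hξv], a, b, ?_⟩
  rw [hab, hu, hv2, hpv, map_zero, LinearMap.zero_apply, smul_zero, sub_zero, smul_smul,
    ← sub_smul, smul_smul]
  congr 2
  have hs := left_ne_zero_of_mul hsc
  have hc := right_ne_zero_of_mul hsc
  field_simp
  linear_combination hκ

/-- The principal vectors in the span of the `Pᵢ x` and `C p (Pᵢ x)`. -/
theorem le_finrank_eigenspace_of_tangent (hP : IsCliffordSystem P)
    (h : IsNormalFrame P t p x ξ) (ht : 0 < Real.sin (4 * t)) {α β κ : ℝ} (hαβ : α ^ 2 ≠ β ^ 2)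
    (hα : Real.sin (2 * t) ^ 2 * α - 2 * α + Real.sin (2 * t) * β =
      -κ * (Real.sin (2 * t) * Real.cos (2 * t)) * α)
    (hβ : Real.sin (2 * t) ^ 2 * β - Real.sin (2 * t) * α =
      -κ * (Real.sin (2 * t) * Real.cos (2 * t)) * β) :
    m ≤ Module.finrank ℝ
      ((shapeOperator (unitSphereGradient (cliffordQuartic P)) x).eigenspace κ) := by
  have hu := h.unitSphereGradient_eq hP ht
  have hsc : Real.sin (2 * t) * Real.cos (2 * t) ≠ 0 := fun h0 => by
    rw [show 4 * t = 2 * (2 * t) by ring, Real.sin_two_mul, mul_assoc, h0] at ht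
    simp at ht
  have hpp : ⟪p, p⟫_ℝ = 1 := by rw [real_inner_self_eq_norm_sq, h.norm_index, one_pow]
  let f : EuclideanSpace ℝ (Fin (m + 1)) →ₗ[ℝ] EuclideanSpace ℝ (Fin (2 * l)) :=
    α • (cliffordMap P).flip x + β • (cliffordMap P p ∘ₗ (cliffordMap P).flip x)
  have hf : ∀ q, f q = α • cliffordMap P q x + β • cliffordMap P p (cliffordMap P q x) :=
    fun q => rfl
  have hfp : ∀ q, cliffordMap P p (f q) =
      β • cliffordMap P q x + α • cliffordMap P p (cliffordMap P q x) := fun q => by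
    rw [hf, map_add, map_smul, map_smul, cliffordMap_self hP, h.norm_index]
    simp [add_comm]
  -- C(p) interchanges the two coefficients, so f q = 0 gives a second equation; the system has
  -- determinant α² - β².
  have hinj : Function.Injective (f.domRestrict (ℝ ∙ p)ᗮ) := by
    rw [← LinearMap.ker_eq_bot, LinearMap.ker_eq_bot']
    rintro ⟨q, hq⟩ h0
    have h0 : f q = 0 := h0
    have h1 := hfp q
    rw [h0, map_zero] at h1
    rw [hf] at h0
    have h2 : (α ^ 2 - β ^ 2) • cliffordMap P q x = 0 := by
      have e : (α ^ 2 - β ^ 2) • cliffordMap P q x =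
          α • (α • cliffordMap P q x + β • cliffordMap P p (cliffordMap P q x)) -
          β • (β • cliffordMap P q x + α • cliffordMap P p (cliffordMap P q x)) := by module
      rw [e, h0, ← h1]; simp
    have h3 := (smul_eq_zero.1 h2).resolve_left (sub_ne_zero.2 hαβ)
    have h4 := norm_cliffordMap_sq hP q x
    rw [h3, h.norm_point] at h4
    have h5 : q = 0 := by simpa using h4.symm
    exact Subtype.ext h5
  have hrank : m = Module.finrank ℝ (f.domRestrict (ℝ ∙ p)ᗮ).range := by
    rw [LinearMap.finrank_range_of_inj hinj]
    have h1 := (ℝ ∙ p).finrank_add_finrank_orthogonal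
    rw [finrank_span_singleton (fun h0 => by simp [h0] at hpp), finrank_euclideanSpace_fin] at h1
    omega
  refine hrank.le.trans (finrank_le_finrank_eigenspace_shapeOperator fun v hv => ?_)
  obtain ⟨⟨q, hq⟩, rfl⟩ := hv
  change ⟪x, f q⟫_ℝ = 0 ∧ ⟪_, f q⟫_ℝ = 0 ∧ ∃ a b : ℝ, fderiv ℝ _ x (f q) = -κ • f q + _
  have hpq : ⟪p, q⟫_ℝ = 0 := Submodule.mem_orthogonal_singleton_iff_inner_right.1 hq
  have hqp : ⟪q, p⟫_ℝ = 0 := by rw [real_inner_comm, hpq]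
  have hxq : ⟪x, cliffordMap P q x⟫_ℝ = 0 := by
    rw [← inner_cliffordMap_left hP, ← inner_cliffordForm, h.form_point, inner_smul_right, hqp,
      mul_zero]
  have hξq : ⟪ξ, cliffordMap P q x⟫_ℝ = 0 := by
    rw [real_inner_comm, ← inner_cliffordForm, h.form_mixed, inner_smul_right, hqp, mul_zero]
  have hxf : ⟪x, f q⟫_ℝ = 0 := by
    rw [hf, inner_add_right, inner_smul_right, inner_smul_right, hxq, ← inner_cliffordMap_left hP,
      h.cliffordMap_point hP, inner_sub_left, inner_smul_left, inner_smul_left, hxq, hξq]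
    simp
  have hξf : ⟪ξ, f q⟫_ℝ = 0 := by
    rw [hf, inner_add_right, inner_smul_right, inner_smul_right, hξq, ← inner_cliffordMap_left hP,
      h.cliffordMap_normal hP, inner_sub_left, inner_smul_left, inner_smul_left, hxq, hξq]
    simp
  -- This keeps C(B(x, f q))x in the span of C(q)x, so the derivative acts on (α, β) by a 2×2
  -- matrix. The hypotheses `hα` and `hβ` are its eigenvector equations.
  have hBf : cliffordForm P x (f q) = (α - Real.sin (2 * t) * β) • q := by
    rw [hf, map_add, map_smul, map_smul, cliffordForm_cliffordMap_right hP,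
      cliffordForm_cliffordMap_comp hP hpq, h.form_point, inner_smul_right, inner_smul_right, hqp,
      hpp, h.norm_point]
    module
  obtain ⟨a, b, hab⟩ := h.fderiv_unitSphereGradient hP ht hxf
  refine ⟨hxf, by rw [hu, hξf], a, b, ?_⟩
  rw [hab, hu, hBf, hfp, hf, map_smul, LinearMap.smul_apply]
  congr 1
  rw [inv_smul_eq_iff₀ hsc]
  match_scalars
  · linear_combination hα
  · linear_combination hβ

end IsNormalFrame

end Curvatures

/-! ### Multiplicities, levels and parallel sets -/

section Family

variable {l m : ℕ}
  {P : Fin (m + 1) → EuclideanSpace ℝ (Fin (2 * l)) →ₗ[ℝ] EuclideanSpace ℝ (Fin (2 * l))}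

/-- The principal curvatures `cot (t + iπ/4)`, `i = 0, …, 3`, in terms of `sin t` and `cos t`. -/
noncomputable def principalCurvature (t : ℝ) : Fin 4 → ℝ :=
  ![Real.cos t / Real.sin t, (Real.cos t - Real.sin t) / (Real.cos t + Real.sin t),
    -(Real.sin t / Real.cos t), -((Real.cos t + Real.sin t) / (Real.cos t - Real.sin t))]

theorem strictAnti_principalCurvature {t : ℝ} (h0 : 0 < Real.sin t)
    (h1 : Real.sin t < Real.cos t) : StrictAnti (principalCurvature t) := by
  have hc : 0 < Real.cos t := h0.trans h1
  have hd : 0 < Real.cos t - Real.sin t := sub_pos.2 h1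
  rw [Fin.strictAnti_iff_succ_lt]
  intro i
  fin_cases i
  · change (Real.cos t - Real.sin t) / (Real.cos t + Real.sin t) < Real.cos t / Real.sin t
    exact ((div_lt_one (by positivity)).2 (by linarith)).trans ((one_lt_div h0).2 h1)
  · change -(Real.sin t / Real.cos t) < (Real.cos t - Real.sin t) / (Real.cos t + Real.sin t)
    exact (neg_neg_of_pos (by positivity)).trans (by positivity)
  · change -((Real.cos t + Real.sin t) / (Real.cos t - Real.sin t)) < -(Real.sin t / Real.cos t)
    exact neg_lt_neg (((div_lt_one hc).2 h1).trans ((one_lt_div hd).2 (by linarith)))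

/-- Dimension count: the lower bounds m, l-m-1, m, l-m-1 sum to 2l-2, the dimension of the tangent
space. -/
theorem IsNormalFrame.finrank_eigenspace_shapeOperator (hm : 0 < m) (hlm : m + 1 < l)
    (hP : IsCliffordSystem P) {t : ℝ} {p : EuclideanSpace ℝ (Fin (m + 1))}
    {x ξ : EuclideanSpace ℝ (Fin (2 * l))} (h : IsNormalFrame P t p x ξ)
    (h0 : 0 < Real.sin t) (h1 : Real.sin t < Real.cos t) :
    (∀ i, Module.finrank ℝ ((shapeOperator (unitSphereGradient (cliffordQuartic P)) x).eigenspace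
        (principalCurvature t i)) = (![m, l - m - 1, m, l - m - 1] : Fin 4 → ℕ) i) ∧
      ∀ r, (shapeOperator (unitSphereGradient (cliffordQuartic P)) x).HasEigenvalue r →
        ∃ i, r = principalCurvature t i := by
  have hc : 0 < Real.cos t := h0.trans h1
  have hd : 0 < Real.cos t - Real.sin t := sub_pos.2 h1
  have hcs := Real.sin_sq_add_cos_sq t
  have hs2 : Real.sin (2 * t) = 2 * Real.sin t * Real.cos t := Real.sin_two_mul t
  have hc2 : Real.cos (2 * t) = Real.cos t ^ 2 - Real.sin t ^ 2 := Real.cos_two_mul' t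
  have h4 : 0 < Real.sin (4 * t) := by
    rw [show 4 * t = 2 * (2 * t) by ring, Real.sin_two_mul, hs2, hc2]
    have : 0 < Real.cos t ^ 2 - Real.sin t ^ 2 := by nlinarith
    positivity
  have hu := h.unitSphereGradient_eq hP h4
  have hne : Real.cos t ^ 2 ≠ Real.sin t ^ 2 := by nlinarith
  refine Module.End.eigenspaces_of_finrank_le _
    (strictAnti_principalCurvature h0 h1).injective (fun i => ?_) ?_
  · fin_cases i
    · have hk : -(Real.cos t / Real.sin t) * (Real.sin (2 * t) * Real.cos (2 * t)) =
          -(2 * Real.cos t ^ 2 * (Real.cos t ^ 2 - Real.sin t ^ 2)) := by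
        rw [hs2, hc2]
        field_simp
      -- Here `hne` fixes (α, β) = (cos t, sin t).
      refine h.le_finrank_eigenspace_of_tangent hP h4 hne
        (κ := Real.cos t / Real.sin t) ?_ ?_ <;> rw [hk, hs2]
      · linear_combination 2 * Real.cos t * (Real.cos t ^ 2 + 1) * hcs
      · linear_combination 2 * Real.sin t * Real.cos t ^ 2 * hcs
    · have := h.le_finrank_eigenspace_of_transverse hm hP h4 (σ := 1) (by norm_num)
        (κ := principalCurvature t 1) (by
          simp only [principalCurvature, Matrix.cons_val_one, Matrix.cons_val_zero, hs2, hc2]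
          field_simp
          linear_combination (Real.cos t + Real.sin t) * hcs)
      exact Nat.sub_le_iff_le_add.2 (Nat.sub_le_iff_le_add.2
        (this.trans_eq (by rw [add_comm m 1, ← add_assoc]; rfl)))
    · have hk : -(-(Real.sin t / Real.cos t)) * (Real.sin (2 * t) * Real.cos (2 * t)) =
          2 * Real.sin t ^ 2 * (Real.cos t ^ 2 - Real.sin t ^ 2) := by
        rw [hs2, hc2]
        field_simp
      -- The other eigenvector is (α, β) = (sin t, cos t).
      refine h.le_finrank_eigenspace_of_tangent hP h4 hne.symm
        (κ := -(Real.sin t / Real.cos t)) ?_ ?_ <;> rw [hk, hs2]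
      · linear_combination 2 * Real.sin t * (Real.sin t ^ 2 + 1) * hcs
      · linear_combination 2 * Real.sin t ^ 2 * Real.cos t * hcs
    · have := h.le_finrank_eigenspace_of_transverse hm hP h4 (σ := -1) (by norm_num)
        (κ := principalCurvature t 3) (by
          change -((Real.cos t + Real.sin t) / (Real.cos t - Real.sin t)) * _ = _
          simp only [hs2, hc2]
          field_simp
          linear_combination -(Real.cos t - Real.sin t) * hcs)
      exact Nat.sub_le_iff_le_add.2 (Nat.sub_le_iff_le_add.2
        (this.trans_eq (by rw [add_comm m 1, ← add_assoc]; rfl)))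
  · have := finrank_hypersurfaceTangentSpace_add_two
      (ξ := unitSphereGradient (cliffordQuartic P)) (x := x) h.norm_point
      (by rw [hu, h.norm_normal]) (by rw [hu, h.inner_eq])
    simp [Fin.sum_univ_four]
    omega

/-- The angle is t = arccos(c)/4, which lies in (0, π/4); this range puts the four curvatures in
decreasing order. -/
theorem exists_angle {c : ℝ} (hc : c ∈ Set.Ioo (-1 : ℝ) 1) :
    ∃ t, Real.cos (4 * t) = c ∧ 0 < Real.sin (4 * t) ∧ 0 < Real.sin t ∧
      Real.sin t < Real.cos t := by
  have h0 := Real.arccos_pos.2 hc.2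
  have h1 : Real.arccos c < Real.pi := by
    rw [← Real.arccos_neg_one]
    exact Real.strictAntiOn_arccos ⟨le_rfl, by norm_num⟩ ⟨hc.1.le, hc.2.le⟩ hc.1
  have e : 4 * (Real.arccos c / 4) = Real.arccos c := by ring
  refine ⟨Real.arccos c / 4, by rw [e, Real.cos_arccos hc.1.le hc.2.le],
    by rw [e]; exact Real.sin_pos_of_pos_of_lt_pi h0 h1,
    Real.sin_pos_of_pos_of_lt_pi (by linarith) (by linarith), ?_⟩
  rw [← Real.cos_pi_div_two_sub]
  exact Real.strictAntiOn_cos ⟨by linarith, by linarith⟩ ⟨by linarith, by linarith⟩ (by linarith)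

/-- The parallel sets of a regular level are the levels. -/
theorem parallelMap_image_sphereLevel (hm : 0 < m) (hlm : m + 1 < l) (hP : IsCliffordSystem P)
    {t : ℝ} (ht : 0 < Real.sin (4 * t)) (ε : ℝ) :
    parallelMap (unitSphereGradient (cliffordQuartic P)) ε ''
        sphereLevel (cliffordQuartic P) (Real.cos (4 * t)) =
      sphereLevel (cliffordQuartic P) (Real.cos (4 * (t - ε))) := by
  ext z
  constructor
  · rintro ⟨x, hx, rfl⟩
    obtain ⟨p, ξ, h⟩ := exists_isNormalFrame hm hlm hP hx
    rw [parallelMap, h.unitSphereGradient_eq hP ht]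
    exact (h.rotate hP ε).mem_sphereLevel
  · intro hz
    obtain ⟨p, ξ, h⟩ := exists_isNormalFrame hm hlm hP hz
    -- The point z may be focal, where the gradient gives no normal; any frame at z, rotated back by
    -- ε, provides a preimage.
    have h' := h.rotate hP (-ε)
    rw [sub_neg_eq_add, sub_add_cancel] at h'
    refine ⟨_, h'.mem_sphereLevel, ?_⟩
    rw [parallelMap, h'.unitSphereGradient_eq hP ht]
    have e : ∀ a b : ℝ, a ^ 2 + b ^ 2 = 1 →
        a • (a • z + (-b) • ξ) + b • (-(-b) • z + a • ξ) = z := fun a b hab => by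
      have : a • (a • z + (-b) • ξ) + b • (-(-b) • z + a • ξ) = (a ^ 2 + b ^ 2) • z := by module
      rw [this, hab, one_smul]
    rw [Real.cos_neg, Real.sin_neg]
    exact e _ _ (Real.cos_sq_add_sin_sq ε)

theorem cliffordQuartic_image_sphere (hm : 0 < m) (hlm : m + 1 < l) (hP : IsCliffordSystem P) :
    cliffordQuartic P '' Metric.sphere 0 1 = Set.Icc (-1) 1 := by
  ext c
  constructor
  · rintro ⟨x, hx, rfl⟩
    have hx : ‖x‖ = 1 := by simpa using hx
    have h := cliffordForm_self_norm_le hP x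
    rw [cliffordQuartic_eq, hx] at *
    constructor <;> nlinarith [norm_nonneg (cliffordForm P x x)]
  · intro hc
    obtain ⟨p, x, ξ, h⟩ := exists_isNormalFrame_of_angle hm hlm hP (Real.arccos c / 4)
    refine ⟨x, h.mem_sphereLevel.1, ?_⟩
    rw [h.quartic_eq, show 4 * (Real.arccos c / 4) = Real.arccos c by ring,
      Real.cos_arccos hc.1 hc.2]

theorem contDiff_sphereGradient_cliffordQuartic (hP : IsCliffordSystem P) :
    ContDiff ℝ ∞ (sphereGradient (cliffordQuartic P)) := by
  rw [show sphereGradient (cliffordQuartic P) = fun x =>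
    quarticGradient P x - (4 * cliffordQuartic P x) • x from
    funext fun x => sphereGradient_cliffordQuartic hP x]
  exact contDiff_quarticGradient.sub
    ((contDiff_const.mul contDiff_cliffordQuartic).smul contDiff_id)

theorem isOrientedHypersurface_sphereLevel (hm : 0 < m) (hlm : m + 1 < l)
    (hP : IsCliffordSystem P) {t : ℝ} (ht : 0 < Real.sin (4 * t)) :
    IsOrientedHypersurface (sphereLevel (cliffordQuartic P) (Real.cos (4 * t)))
      (unitSphereGradient (cliffordQuartic P)) := by
  have hg := contDiff_sphereGradient_cliffordQuartic hP
  have hne : ∀ x ∈ sphereLevel (cliffordQuartic P) (Real.cos (4 * t)),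
      sphereGradient (cliffordQuartic P) x ≠ 0 := fun x hx => by
    obtain ⟨p, ξ, h⟩ := exists_isNormalFrame hm hlm hP hx
    rw [h.sphereGradient_eq hP, ← norm_ne_zero_iff, norm_smul, h.norm_normal, mul_one,
      norm_ne_zero_iff]
    positivity
  -- One global defining function, F - cos 4t, serves at every point.
  refine ⟨?_, fun x hx => hx.1, ⟨{x | sphereGradient (cliffordQuartic P) x ≠ 0}, ?_, hne, ?_⟩,
    fun x hx => ?_, fun x hx => ⟨Set.univ, fun y => cliffordQuartic P y - Real.cos (4 * t),
      isOpen_univ, Set.mem_univ _, (contDiff_cliffordQuartic.sub contDiff_const).contDiffOn,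
      ?_, ?_⟩⟩
  · obtain ⟨p, x, ξ, h⟩ := exists_isNormalFrame_of_angle hm hlm hP t
    exact ⟨x, h.mem_sphereLevel⟩
  · exact isOpen_ne_fun hg.continuous continuous_const
  · exact (hg.contDiffOn.norm ℝ fun x hx => hx).inv (fun x hx => norm_ne_zero_iff.2 hx)
      |>.smul hg.contDiffOn
  · rw [unitSphereGradient, norm_smul, norm_inv, norm_norm,
      inv_mul_cancel₀ (norm_ne_zero_iff.2 (hne x hx))]
  · ext y
    simp [sphereLevel, sub_eq_zero]
  · rintro y ⟨hy, -⟩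
    have e : sphereGradient (fun y => cliffordQuartic P y - Real.cos (4 * t)) y =
        sphereGradient (cliffordQuartic P) y := by
      simp only [sphereGradient, gradient, fderiv_sub_const]
    rw [e]
    refine ⟨hne y hy, ‖sphereGradient (cliffordQuartic P) y‖, ?_⟩
    rw [unitSphereGradient, smul_inv_smul₀ (norm_ne_zero_iff.2 (hne y hy))]

theorem isIsoparametricHypersurface_sphereLevel (hm : 0 < m) (hlm : m + 1 < l)
    (hP : IsCliffordSystem P) {t : ℝ} (ht : 0 < Real.sin (4 * t)) (h0 : 0 < Real.sin t)
    (h1 : Real.sin t < Real.cos t) :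
    IsIsoparametricHypersurface (sphereLevel (cliffordQuartic P) (Real.cos (4 * t)))
      (unitSphereGradient (cliffordQuartic P)) 4
      ![(m : ℤ), (l : ℤ) - m - 1, m, (l : ℤ) - m - 1] := by
  refine ⟨isOrientedHypersurface_sphereLevel hm hlm hP ht, principalCurvature t,
    strictAnti_principalCurvature h0 h1, fun x hx => ?_⟩
  obtain ⟨p, ξ, h⟩ := exists_isNormalFrame hm hlm hP hx
  obtain ⟨hr, hex⟩ := h.finrank_eigenspace_shapeOperator hm hlm hP h0 h1
  have hpos : ∀ i, 0 < (![m, l - m - 1, m, l - m - 1] : Fin 4 → ℕ) i := fun i => by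
    fin_cases i <;> simp <;> omega
  refine ⟨fun r => ⟨hex r, ?_⟩, fun i => ?_⟩
  · rintro ⟨i, rfl⟩ hbot
    have := hpos i
    rw [← hr i] at this
    exact this.ne' (Submodule.finrank_eq_zero.2 hbot)
  · rw [hr i]
    fin_cases i <;> simp <;> omega

end Family

theorem theorem4p1 (l m : ℕ) (hl : 0 < l) (hm : 0 < m)
    (P : Fin (m + 1) → EuclideanSpace ℝ (Fin (2 * l)) →ₗ[ℝ] EuclideanSpace ℝ (Fin (2 * l)))
    (hP : IsCliffordSystem P) (m₁ m₂ : ℤ) (hm₁ : m₁ = m) (hm₂ : m₂ = (l : ℤ) - m - 1) :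
    -- the Cartan–Münzner differential equations
    (ContDiff ℝ ∞ (cliffordQuartic P) ∧
      (∀ x, ‖∇ (cliffordQuartic P) x‖ ^ 2 = 16 * ‖x‖ ^ 6) ∧
      (∀ x, Δ (cliffordQuartic P) x = 8 * ((m₂ : ℝ) - m₁) * ‖x‖ ^ 2)) ∧
    (0 < m₂ →
      -- the values of `F` on the unit sphere are exactly those in `[-1, 1]`
      cliffordQuartic P '' Metric.sphere 0 1 = Set.Icc (-1) 1 ∧
      -- the regular levels, oriented by the normalized gradient, form an isoparametric family
      IsIsoparametricFamily (fun c : Set.Ioo (-1 : ℝ) 1 => sphereLevel (cliffordQuartic P) c)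
        (fun _ => unitSphereGradient (cliffordQuartic P)) 4 ![m₁, m₂, m₁, m₂] ∧
      -- all the parallel sets of a regular level, focal sets included, are exactly the levels
      ∀ c ∈ Set.Ioo (-1 : ℝ) 1,
        Set.range (fun ε : ℝ => parallelMap (unitSphereGradient (cliffordQuartic P)) ε ''
            sphereLevel (cliffordQuartic P) c) =
          sphereLevel (cliffordQuartic P) '' Set.Icc (-1) 1) := by
  subst hm₁ hm₂
  refine ⟨⟨contDiff_cliffordQuartic, fun x => ?_, fun x => ?_⟩, fun hpos => ?_⟩
  · rw [gradient_cliffordQuartic hP, norm_quarticGradient_sq hP]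
  · rw [laplacian_cliffordQuartic hm hP]
    push_cast
    ring
  have hlm : m + 1 < l := by omega
  refine ⟨cliffordQuartic_image_sphere hm hlm hP, ⟨?_, ?_⟩, ?_⟩
  · rintro ⟨c, hc⟩
    obtain ⟨t, rfl, ht, h0, h1⟩ := exists_angle hc
    exact isIsoparametricHypersurface_sphereLevel hm hlm hP ht h0 h1
  · rintro ⟨c, hc⟩ ⟨c', hc'⟩
    obtain ⟨t, rfl, ht, -, -⟩ := exists_angle hc
    obtain ⟨t', rfl, ht', -, -⟩ := exists_angle hc'
    refine ⟨t - t', ?_, fun x hx => ?_⟩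
    · have h := parallelMap_image_sphereLevel hm hlm hP ht (t - t')
      rwa [sub_sub_cancel] at h
    · obtain ⟨p, ξ, h⟩ := exists_isNormalFrame hm hlm hP hx
      have h' := h.rotate hP (t - t')
      rw [sub_sub_cancel] at h'
      rw [parallelMap, h.unitSphereGradient_eq hP ht, h'.unitSphereGradient_eq hP ht']
  · intro c hc
    obtain ⟨t, rfl, ht, -, -⟩ := exists_angle hc
    ext M
    constructor
    · rintro ⟨ε, rfl⟩
      exact ⟨_, Real.cos_mem_Icc _, (parallelMap_image_sphereLevel hm hlm hP ht ε).symm⟩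
    · rintro ⟨c', hc', rfl⟩
      -- The value ε for which t - ε = arccos(c')/4; the endpoints c' = ±1 give the focal sets.
      refine ⟨t - Real.arccos c' / 4, ?_⟩
      rw [← Real.cos_arccos hc'.1 hc'.2]
      have h := parallelMap_image_sphereLevel hm hlm hP ht (t - Real.arccos c' / 4)
      rw [sub_sub_cancel, show 4 * (Real.arccos c' / 4) = Real.arccos c' by ring] at h
      simpa [Real.cos_arccos hc'.1 hc'.2] using h
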